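/- Let $G=(V,E)$ be a finite undirected simple graph with $n\ge 1$ vertices (the user chunks), let $1\le t\le n$, and let $P(G,\le t)$ be the set of all files, i.e. of all simple paths $p=(x_{i_1},\dots,x_{i_\ell})$ of $G$ with $1\le \ell(p)=\ell\le t$ vertices. A linearly coded store of length $m$ is a sequence $s=(s_1,\dots,s_m)$ in which each $s_j$ is a bitwise XOR ($\mathbb F_2$-linear combination) of user chunks and such that every user chunk is an XOR of some of the $s_j$. For a file $p$, $\mathrm{MinS}(s,p)$ is the smallest length of a contiguous substring of $s$ from whose entries every chunk of $p$ can be obtained by XORs, divided by $\ell(p)$. The stretch metric of $s$ is $\max_{p\in P(G,\le t)}\mathrm{MinS}(s,p)$, and $S^c_t(G,m)$ is its minimum over all linearly coded stores of length $m$; a store attaining it is called optimal. Consider stores with one redundant chunk, i.e. $m=n+1$. (1) There is an optimal linearly coded store of length $n+1$ which is an interleaving of two sequences $x_{a_1},\dots,x_{a_{n-N}}$ and $y_1,\dots,y_{N+1}$, for some $1\le N\le n$, where $\{x_{a_i}\}_{i=1}^{n-N}$ and $\{x_{b_i}\}_{i=1}^{N}$ partition $V$, $y_1=x_{b_1}$,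 $y_{N+1}=x_{b_N}$ and $y_i=x_{b_{i-1}}\oplus x_{b_i}$ for $1<i<N+1$, and in which every stored chunk is an XOR of at most $2$ user chunks. (2) In every store of length $n+1$ of the form described in (1), every stored chunk is an XOR of at most $2$ user chunks. (3) XORing more than two chunks does not reduce fragmentation: the minimum of the stretch metric over those linearly coded stores of length $n+1$ in which each stored chunk is an XOR of at most $2$ user chunks equals $S^c_t(G,n+1)$. -/

import Mathlib

/-- The files of the file model `P(G, ≤ t)`: the simple (self-avoiding) paths of `G`, written as
the nonempty lists of their chunks, with at most `t` chunks. The length of the list is the number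
of chunks of the file. -/
def fileModel {V : Type*} (G : SimpleGraph V) (t : ℕ) : Set (List V) :=
  {p | p ≠ [] ∧ p.Nodup ∧ p.IsChain G.Adj ∧ p.length ≤ t}

/-- The coefficient vector over `𝔽₂` of the uncoded user chunk `v`. -/
def userChunk {V : Type*} [DecidableEq V] (v : V) : V → ZMod 2 := Pi.single v 1

/-- A linearly coded chunk store of length `m` for the user chunks `V`: a sequence of `m` chunks,
each of which is an XOR of user chunks (given by its coefficient vector over `𝔽₂`), such that every
user chunk is an XOR of stored chunks, so that the store allows exact recovery. -/
structure CodedStore (V : Type*) [DecidableEq V] (m : ℕ) where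
  /-- the coefficient vector of the stored chunk at each position -/
  chunk : Fin m → V → ZMod 2
  recovers_all : ∀ v : V, userChunk v ∈ Submodule.span (ZMod 2) (Set.range chunk)

namespace CodedStore

variable {V : Type*} [DecidableEq V] {m : ℕ}

/-- The substring of `s` made of the positions `i, …, i + L - 1` allows for recovering all chunks
of the file `p`: each of them is an XOR of stored chunks of the substring. -/
def WindowRecovers (s : CodedStore V m) (i L : ℕ) (p : List V) : Prop :=
  ∀ v ∈ p, userChunk v ∈
    Submodule.span (ZMod 2) (s.chunk '' {j : Fin m | i ≤ (j : ℕ) ∧ (j : ℕ) < i + L})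

/-- The length of a shortest substring of `s` that allows for recovering the file `p`. (The set is
nonempty, since the whole store recovers every file.) -/
noncomputable def minWindow (s : CodedStore V m) (p : List V) : ℕ :=
  sInf {L : ℕ | ∃ i : ℕ, i + L ≤ m ∧ s.WindowRecovers i L p}

/-- The stretch number `MinS(s, p)`. -/
noncomputable def stretchNumber (s : CodedStore V m) (p : List V) : ℝ :=
  (s.minWindow p : ℝ) / (p.length : ℝ)

/-- The stretch metric of the store `s`: the maximum of the stretch numbers over all files of
`P(G, ≤ t)` (over a finite vertex set there are only finitely many files). -/
noncomputable def stretchMetric (s : CodedStore V m) (G : SimpleGraph V) (t : ℕ) : ℝ :=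
  ⨆ p : fileModel G t, s.stretchNumber p.1

/-- `s` minimizes the stretch metric among all linearly coded stores of the same length. -/
def IsOptimal (s : CodedStore V m) (G : SimpleGraph V) (t : ℕ) : Prop :=
  ∀ s' : CodedStore V m, s.stretchMetric G t ≤ s'.stretchMetric G t

/-- Each stored chunk of `s` is an XOR of at most `k` distinct user chunks. -/
def XorsAtMost [Fintype V] (s : CodedStore V m) (k : ℕ) : Prop :=
  ∀ j : Fin m, (Finset.univ.filter fun v : V => s.chunk j v ≠ 0).card ≤ k

end CodedStore

/-- The stretch metric `S^c_t(G, m)` of linearly coded stores of length `m`. -/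
noncomputable def codedStretch {V : Type*} [DecidableEq V] (G : SimpleGraph V) (t m : ℕ) : ℝ :=
  ⨅ s : CodedStore V m, s.stretchMetric G t

/-- The same minimum, taken only over the stores whose chunks each XOR at most `k` user chunks. -/
noncomputable def xorStretch {V : Type*} [Fintype V] [DecidableEq V] (G : SimpleGraph V)
    (t m k : ℕ) : ℝ :=
  ⨅ s : {s : CodedStore V m // s.XorsAtMost k}, s.1.stretchMetric G t

/-- The chunks `b₁, b₁ ⊕ b₂, b₂ ⊕ b₃, …, b_{N-1} ⊕ b_N, b_N` (here indexed from `0` to `N`). -/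
def chainChunk {V : Type*} [DecidableEq V] {N : ℕ} (hN : 0 < N) (b : Fin N → V)
    (i : Fin (N + 1)) : V → ZMod 2 :=
  if h0 : (i : ℕ) = 0 then userChunk (b ⟨0, hN⟩)
  else if hl : (i : ℕ) = N then userChunk (b ⟨N - 1, by omega⟩)
  else userChunk (b ⟨i - 1, by omega⟩) + userChunk (b ⟨i, by omega⟩)

/-- `s` is an interleaving of a sequence `a₁, …, a_K` of uncoded chunks and of the sequence
`b₁, b₁ ⊕ b₂, …, b_{N-1} ⊕ b_N, b_N`, where `N ≥ 1` and the user chunks `a₁, …, a_K` and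
`b₁, …, b_N` are pairwise distinct and partition `V`. The increasing maps `α` and `β` give the
positions of the members of the two sequences. -/
def CodedStore.IsChainInterleaving {V : Type*} [DecidableEq V] {m : ℕ}
    (s : CodedStore V m) : Prop :=
  ∃ (K N : ℕ) (hN : 0 < N) (a : Fin K → V) (b : Fin N → V)
    (α : Fin K → Fin m) (β : Fin (N + 1) → Fin m),
    Function.Injective a ∧ Function.Injective b ∧ IsCompl (Set.range a) (Set.range b) ∧
    StrictMono α ∧ StrictMono β ∧ IsCompl (Set.range α) (Set.range β) ∧
    (∀ i, s.chunk (α i) = userChunk (a i)) ∧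
    (∀ i, s.chunk (β i) = chainChunk hN b i)

/-! With one redundant chunk the stored chunks satisfy a single nontrivial relation `C`; let `p` and
`q` be the ends of its support. Each user chunk then has exactly two representations, `A` and `A +
C`, and a window recovers it iff it contains the support of one of them. By `support_dichotomy`,
either one representation `X v` lies in every window that recovers `v`, or every such window
contains `[p, r v]` or `[l v, q]`.

Among the chunks of the second kind, `exists_strictMono_dominating` picks a chain `b` along which
`l` and `r` increase and which dominates the rest. The successive differences of `0, X (b 0), …, X
(b (N-1)), C`, the differences of dominated chunks and their dominators, and the vectors `X v` of
the first kind form a basis. A nonzero term of its determinant gives each basis vector its own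
position in its support (`exists_chain_representatives`).

Each chunk outside the chain is stored uncoded at its position, and the chain is written on the
sorted positions of the successive differences. Then `b k` is the sum of a prefix of the chain
inside `[p, r (b k)]` and of a suffix inside `[l (b k), q]`, so no recovering window is lost.
Applied to a minimizer of the stretch metric, this gives the theorem. -/

/-! ### Dominating chains and distinct representatives -/

/-- Greedy choice of a Pareto front: start with the least `r`, ties broken by the largest `l`. That
element dominates everything with no larger `l`, and everything with larger `l` has strictly larger
`r`, so recursion on the latter keeps both sequences strictly increasing. -/
theorem exists_strictMono_dominating {V : Type*} (l r : V → ℕ) (T : Finset V) :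
    ∃ (N : ℕ) (b : Fin N → V), (∀ i, b i ∈ T) ∧ StrictMono (l ∘ b) ∧ StrictMono (r ∘ b) ∧
      ∀ u ∈ T, ∃ i, l u ≤ l (b i) ∧ r (b i) ≤ r u := by
  induction T using Finset.strongInduction with
  | H T ih =>
    rcases T.eq_empty_or_nonempty with rfl | hT
    · exact ⟨0, Fin.elim0, fun i => i.elim0, fun i => i.elim0, fun i => i.elim0, by simp⟩
    obtain ⟨w, hwT, hw⟩ := T.exists_min_image r hT
    obtain ⟨v, hv, hvl⟩ := (T.filter fun u => r u = r w).exists_max_image l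
      ⟨w, by simp [hwT]⟩
    simp only [Finset.mem_filter] at hv hvl
    have hlt : ∀ u ∈ T, l v < l u → r v < r u := by
      intro u hu h
      rcases (hw u hu).lt_or_eq with h1 | h1
      · rw [hv.2]; exact h1
      · exact absurd (hvl u ⟨hu, h1.symm⟩) (by omega)
    obtain ⟨N, b, hbT, hl, hr, hdom⟩ := ih (T.filter fun u => l v < l u)
      ((Finset.filter_ssubset).2 ⟨v, hv.1, by simp⟩)
    simp only [Finset.mem_filter] at hbT hdom
    refine ⟨N + 1, Fin.cons v b, ?_, ?_, ?_, ?_⟩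
    · intro i
      refine Fin.cases hv.1 (fun i => ?_) i
      simpa using (hbT i).1
    · intro i j hij
      induction j using Fin.cases with
      | zero => exact absurd hij (by simp)
      | succ j =>
        induction i using Fin.cases with
        | zero => simpa using (hbT j).2
        | succ i => simpa using hl (Fin.succ_lt_succ_iff.1 hij)
    · intro i j hij
      induction j using Fin.cases with
      | zero => exact absurd hij (by simp)
      | succ j =>
        induction i using Fin.cases with
        | zero => simpa using hlt _ (hbT j).1 (hbT j).2
        | succ i => simpa using hr (Fin.succ_lt_succ_iff.1 hij)
    · intro u hu
      by_cases h : l v < l u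
      · obtain ⟨i, hi⟩ := hdom u ⟨hu, h⟩
        exact ⟨i.succ, by simpa using hi⟩
      · exact ⟨0, by simpa [hv.2] using ⟨not_lt.1 h, hw u hu⟩⟩

/-- Pigeonhole: the `i + 1` indices up to `i` cannot inject into the `i` indices below `i`. -/
theorem exists_le_perm_ge {N : ℕ} (σ : Equiv.Perm (Fin N)) (i : Fin N) : ∃ k ≤ i, i ≤ σ k := by
  by_contra! h
  have := Finset.card_le_card_of_injOn σ (s := Finset.Iic i) (t := Finset.Iio i)
    (fun k hk => by simpa using h k (by simpa using hk)) σ.injective.injOn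
  simp at this

theorem exists_ge_perm_le {N : ℕ} (σ : Equiv.Perm (Fin N)) (i : Fin N) : ∃ k ≥ i, σ k ≤ i := by
  by_contra! h
  have := Finset.card_le_card_of_injOn σ (s := Finset.Ici i) (t := Finset.Ioi i)
    (fun k hk => by simpa using h k (by simpa using hk)) σ.injective.injOn
  simp at this
  omega

/-- Sorting distinct representatives of intervals with monotone endpoints keeps each of them in
its interval. -/
theorem exists_strictMono_representatives {N m : ℕ} (γ : Fin N → Fin m)
    (hγ : Function.Injective γ) :
    ∃ β : Fin N → Fin m, StrictMono β ∧ Set.range β = Set.range γ ∧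
      ∀ lo hi : Fin N → ℕ, Monotone lo → Monotone hi → (∀ i, lo i ≤ γ i ∧ (γ i : ℕ) ≤ hi i) →
        ∀ i, lo i ≤ β i ∧ (β i : ℕ) ≤ hi i := by
  have hm := Tuple.monotone_sort γ
  refine ⟨γ ∘ Tuple.sort γ, hm.strictMono_of_injective (hγ.comp (Equiv.injective _)),
    (Tuple.sort γ).surjective.range_comp γ, fun lo hi hlo hhi h i => ⟨?_, ?_⟩⟩
  · obtain ⟨k, hk, hk'⟩ := exists_le_perm_ge (Tuple.sort γ) i
    exact (hlo hk').trans ((h _).1.trans (hm hk))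
  · obtain ⟨k, hk, hk'⟩ := exists_ge_perm_le (Tuple.sort γ) i
    exact (Fin.le_def.1 (hm hk)).trans ((h _).2.trans (hhi hk'))

/-- A spanning family of the right size has distinct representatives in the supports of its
members. -/
theorem exists_equiv_apply_ne_zero {K ι : Type*} [Field K] [Fintype ι] {m : ℕ}
    (hc : Fintype.card ι = m) (w : ι → Fin m → K)
    (hw : Submodule.span K (Set.range w) = ⊤) : ∃ φ : ι ≃ Fin m, ∀ x, w x (φ x) ≠ 0 := by
  let e : ι ≃ Fin m := Fintype.equivFinOfCardEq hc
  have hli : LinearIndependent K w :=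
    linearIndependent_of_top_le_span_of_card_eq_finrank hw.ge (by simp [hc])
  have hli' : LinearIndependent K (Matrix.of fun i => w (e.symm i)).row :=
    hli.comp _ e.symm.injective
  rw [Matrix.linearIndependent_rows_iff_isUnit, Matrix.isUnit_iff_isUnit_det,
    isUnit_iff_ne_zero, ← Matrix.det_transpose, Matrix.det_apply] at hli'
  obtain ⟨σ, -, hσ⟩ := Finset.exists_ne_zero_of_sum_ne_zero hli'
  have hσ' := right_ne_zero_of_smul hσ
  refine ⟨e.trans σ, fun x => ?_⟩
  simpa using Finset.prod_ne_zero_iff.1 hσ' (e x) (Finset.mem_univ _)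

theorem exists_coeff_of_mem_span_image {K M ι : Type*} [Field K] [AddCommGroup M] [Module K M]
    [Fintype ι] {c : ι → M} {S : Set ι} {x : M} (hx : x ∈ Submodule.span K (c '' S)) :
    ∃ y : ι → K, (∀ j, y j ≠ 0 → j ∈ S) ∧ Fintype.linearCombination K c y = x := by
  obtain ⟨y, hy, rfl⟩ := (Finsupp.mem_span_image_iff_linearCombination K).1 hx
  refine ⟨y, fun j hj => ?_, ?_⟩
  · exact (Finsupp.mem_supported K y).1 hy (by simpa using hj)
  · simp [Finsupp.linearCombination_apply, Fintype.linearCombination_apply, Finsupp.sum_fintype]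

/-! ### The two representations of a user chunk -/

/-- The vector `x` is supported in the positions `i, …, j - 1`. -/
def SupportedIn {m : ℕ} (x : Fin m → ZMod 2) (i j : ℕ) : Prop :=
  ∀ k : Fin m, x k ≠ 0 → i ≤ (k : ℕ) ∧ (k : ℕ) < j

/-- `A` and `A + C` agree outside `[p, q]`. If the support of one of them spans `[p, q]`, every
interval containing it contains the other support too. This fails only if both live inside `[p, q]`,
with `A` starting at `p` and `A + C` ending at `q`. -/
theorem support_dichotomy_of_apply_eq_zero {m : ℕ} {A C : Fin m → ZMod 2} {p q : Fin m} (hp : C p ≠ 0) (hq : C q ≠ 0)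
    (hC : ∀ k, C k ≠ 0 → p ≤ k ∧ k ≤ q) (hA : A q = 0) :
    (∃ X, (X = A ∨ X = A + C) ∧
      ∀ i j, SupportedIn A i j ∨ SupportedIn (A + C) i j → SupportedIn X i j) ∨
    (∃ l r : Fin m, (∀ k, A k ≠ 0 → p ≤ k ∧ k ≤ r) ∧ (∀ k, (A + C) k ≠ 0 → l ≤ k ∧ k ≤ q) ∧
      A p ≠ 0 ∧ A r ≠ 0 ∧ (A + C) l ≠ 0 ∧ (A + C) q ≠ 0) := by
  have hBq : (A + C) q ≠ 0 := by simpa [hA] using hq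
  have hout : ∀ k, ¬ (p ≤ k ∧ k ≤ q) → (A + C) k = A k := fun k hk => by
    have : C k = 0 := by by_contra h; exact hk (hC k h)
    simp [this]
  by_cases hAp : A p = 0
  · have hBp : (A + C) p ≠ 0 := by simpa [hAp] using hp
    refine .inl ⟨A, .inl rfl, fun i j h => h.elim id fun h k hk => ?_⟩
    by_cases hkk : p ≤ k ∧ k ≤ q
    · have h1 := h p hBp
      have h2 := h q hBq
      simp only [Fin.le_def] at hkk
      omega
    · exact h k (by rwa [hout k hkk])
  by_cases hz : ∃ z, q < z ∧ A z ≠ 0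
  · obtain ⟨z, hqz, hz⟩ := hz
    refine .inl ⟨A + C, .inr rfl, fun i j h => h.elim (fun h k hk => ?_) id⟩
    by_cases hkk : p ≤ k ∧ k ≤ q
    · have h1 := h p hAp
      have h2 := h z hz
      simp only [Fin.le_def, Fin.lt_def] at hkk hqz
      omega
    · exact h k (by rwa [← hout k hkk])
  by_cases hy : ∃ y, y < p ∧ A y ≠ 0
  · obtain ⟨y, hyp, hy⟩ := hy
    refine .inl ⟨A, .inl rfl, fun i j h => h.elim id fun h k hk => ?_⟩
    by_cases hkk : p ≤ k ∧ k ≤ q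
    · have h1 := h y (by rwa [hout y (by simp [hyp])])
      have h2 := h q hBq
      simp only [Fin.le_def, Fin.lt_def] at hkk hyp
      omega
    · exact h k (by rwa [hout k hkk])
  push Not at hz hy
  have hApq : ∀ k, A k ≠ 0 → p ≤ k ∧ k ≤ q := fun k hk =>
    ⟨not_lt.1 fun h => hk (hy k h), not_lt.1 fun h => hk (hz k h)⟩
  have hBpq : ∀ k, (A + C) k ≠ 0 → p ≤ k ∧ k ≤ q := fun k hk => by
    by_contra h
    exact h (hApq k (by rwa [← hout k h]))
  obtain ⟨r, hr, hr'⟩ := (Finset.univ.filter fun k => A k ≠ 0).exists_max_image id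
    ⟨p, by simpa using hAp⟩
  obtain ⟨l, hl, hl'⟩ := (Finset.univ.filter fun k => (A + C) k ≠ 0).exists_min_image id
    ⟨q, by simpa using hBq⟩
  simp only [Finset.mem_filter, Finset.mem_univ, true_and, id] at hr hr' hl hl'
  exact .inr ⟨l, r, fun k hk => ⟨(hApq k hk).1, hr' k hk⟩, fun k hk => ⟨hl' k hk, (hBpq k hk).2⟩,
    hAp, hr, hl, hBq⟩

/-- Of the two representations `A` and `A + C` of a chunk, either one lies in every interval that
contains one of them, or one of them, `X`, begins where `C` begins and the other one ends where `C`
ends. -/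
theorem support_dichotomy {m : ℕ} (A : Fin m → ZMod 2) {C : Fin m → ZMod 2} {p q : Fin m}
    (hp : C p ≠ 0) (hq : C q ≠ 0) (hC : ∀ k, C k ≠ 0 → p ≤ k ∧ k ≤ q) :
    ∃ X, (X = A ∨ X = A + C) ∧
      ((∀ i j, SupportedIn A i j ∨ SupportedIn (A + C) i j → SupportedIn X i j) ∨
      ∃ l r : Fin m, (∀ k, X k ≠ 0 → p ≤ k ∧ k ≤ r) ∧ (∀ k, (X + C) k ≠ 0 → l ≤ k ∧ k ≤ q) ∧
        p ≤ l ∧ r ≤ q ∧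
        ∀ i j, SupportedIn A i j ∨ SupportedIn (A + C) i j →
          (i ≤ (p : ℕ) ∧ (r : ℕ) < j) ∨ (i ≤ (l : ℕ) ∧ (q : ℕ) < j)) := by
  have hCC : C + C = 0 := by ext k; exact CharTwo.add_self_eq_zero _
  -- Over `𝔽₂` exactly one of `A` and `A + C` vanishes at `q`, and the two play symmetric roles.
  obtain ⟨D, hD, hDq, hDA, hX⟩ : ∃ D, (D = A ∨ D = A + C) ∧ D q = 0 ∧
      (∀ i j, SupportedIn A i j ∨ SupportedIn (A + C) i j →
        SupportedIn D i j ∨ SupportedIn (D + C) i j) ∧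
      (∀ X, X = D ∨ X = D + C → X = A ∨ X = A + C) := by
    by_cases hA : A q = 0
    · exact ⟨A, .inl rfl, hA, fun i j h => h, fun X h => h⟩
    · have h2 : ∀ x : ZMod 2, x ≠ 0 → x = 1 := by decide
      refine ⟨A + C, .inr rfl, ?_, fun i j h => ?_, fun X h => ?_⟩
      · simp only [Pi.add_apply, h2 _ hA, h2 _ hq]; decide
      · rw [add_assoc, hCC, add_zero]; exact h.symm
      · rw [add_assoc, hCC, add_zero] at h; exact h.symm
  rcases support_dichotomy_of_apply_eq_zero hp hq hC hDq with ⟨X, hXD, h⟩ | ⟨l, r, h1, h2, h3, h4, h5, h6⟩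
  · exact ⟨X, hX X hXD, .inl fun i j hij => h i j (hDA i j hij)⟩
  · refine ⟨D, hD, .inr ⟨l, r, h1, h2, ?_, ?_, fun i j hij => ?_⟩⟩
    · by_contra hlp
      have hCl : C l = 0 := by by_contra h; exact hlp (hC l h).1
      exact hlp (h1 l (by simpa [hCl] using h5)).1
    · by_contra hrq
      have hCr : C r = 0 := by by_contra h; exact hrq (hC r h).2
      exact hrq (h2 r (by simpa [hCr] using h4)).2
    · rcases hDA i j hij with h | h
      · exact .inl ⟨(h p h3).1, (h r h4).2⟩
      · exact .inr ⟨(h l h5).1, (h q h6).2⟩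

/-! ### Decoding and assembling chain interleavings -/

/-- Prefix sums of the chain telescope to a single user chunk. -/
theorem userChunk_mem_of_chainChunk_le {V : Type*} [DecidableEq V] {N : ℕ} (hN : 0 < N)
    (b : Fin N → V) (S : Submodule (ZMod 2) (V → ZMod 2)) (k : ℕ) (hk : k < N)
    (h : ∀ j : Fin (N + 1), (j : ℕ) ≤ k → chainChunk hN b j ∈ S) : userChunk (b ⟨k, hk⟩) ∈ S := by
  induction k with
  | zero => simpa [chainChunk] using h 0 (by simp)
  | succ k ih =>
    have h1 := ih (by omega) fun j hj => h j (by omega)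
    have h2 := h ⟨k + 1, by omega⟩ le_rfl
    have h3 : k + 1 ≠ N := by omega
    simp only [chainChunk, Nat.add_eq_zero_iff, one_ne_zero, and_false, dite_false, h3,
      Nat.add_sub_cancel] at h2
    exact (S.add_mem_iff_right h1).1 h2

/-- Suffix sums telescope as well; `d` counts the members of `b` after `k` and drives the induction
from the far end. -/
theorem userChunk_mem_of_chainChunk_gt {V : Type*} [DecidableEq V] {N : ℕ} (hN : 0 < N)
    (b : Fin N → V) (S : Submodule (ZMod 2) (V → ZMod 2)) (d k : ℕ) (hk : k < N)
    (hd : k + d + 1 = N)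
    (h : ∀ j : Fin (N + 1), k < (j : ℕ) → chainChunk hN b j ∈ S) : userChunk (b ⟨k, hk⟩) ∈ S := by
  induction d generalizing k with
  | zero =>
    have h1 := h (Fin.last N) (by simpa using hk)
    have h2 : N ≠ 0 := by omega
    have h3 : N - 1 = k := by omega
    simpa [chainChunk, h2, h3] using h1
  | succ d ih =>
    have h1 := ih (k + 1) (by omega) (by omega) fun j hj => h j (by omega)
    have h2 := h ⟨k + 1, by omega⟩ (by simp)
    have h3 : k + 1 ≠ N := by omega
    simp only [chainChunk, Nat.add_eq_zero_iff, one_ne_zero, and_false, dite_false, h3,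
      Nat.add_sub_cancel] at h2
    exact (S.add_mem_iff_left h1).1 h2

/-- A placement of the uncoded chunks outside `b` and of the chain on `b` at the positions of a
store yields a chain interleaving. -/
theorem exists_chainInterleaving {V : Type*} [Fintype V] [DecidableEq V] {m N : ℕ} (hN : 0 < N)
    (b : Fin N → V) (hb : Function.Injective b) (φ : Option V ≃ Fin m)
    (β : Fin (N + 1) → Fin m) (hβ : StrictMono β)
    (hr : Set.range β = Set.range (Fin.cons (φ none) fun i => φ (some (b i)) :
      Fin (N + 1) → Fin m)) :
    ∃ s : CodedStore V m, s.IsChainInterleaving ∧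
      (∀ v ∉ Set.range b, s.chunk (φ (some v)) = userChunk v) ∧
      (∀ i, s.chunk (β i) = chainChunk hN b i) := by
  classical
  have hrange : ∀ v, φ (some v) ∈ Set.range β ↔ v ∈ Set.range b := by
    intro v
    rw [hr, Fin.range_cons]
    simp
  have hnone : φ none ∈ Set.range β := by
    rw [hr]; exact ⟨0, by simp⟩
  -- The default `0` is never used: the only position without a user chunk, `φ none`, lies on the
  -- chain.
  let c : Fin m → V → ZMod 2 := fun j =>
    if h : ∃ i, β i = j then chainChunk hN b h.choose
    else ((φ.symm j).map userChunk).getD 0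
  have hcβ : ∀ i, c (β i) = chainChunk hN b i := by
    intro i
    have h : ∃ i', β i' = β i := ⟨i, rfl⟩
    simp only [c, dif_pos h]
    rw [hβ.injective h.choose_spec]
  have hcφ : ∀ v ∉ Set.range b, c (φ (some v)) = userChunk v := by
    intro v hv
    have h : ¬ ∃ i, β i = φ (some v) := fun h => hv ((hrange v).1 h)
    simp only [c, dif_neg h]
    simp
  have hrec : ∀ v, userChunk v ∈ Submodule.span (ZMod 2) (Set.range c) := by
    intro v
    by_cases hv : v ∈ Set.range b
    · obtain ⟨i, rfl⟩ := hv
      exact userChunk_mem_of_chainChunk_le hN b _ i i.2 fun j _ =>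
        Submodule.subset_span ⟨β j, hcβ j⟩
    · exact Submodule.subset_span ⟨_, hcφ v hv⟩
  refine ⟨⟨c, hrec⟩, ?_, hcφ, hcβ⟩
  let A : Finset (Fin m) := Finset.univ.filter fun j => j ∉ Set.range β
  have hA : ∀ x : Fin A.card, ∃ v, φ (some v) = A.orderEmbOfFin rfl x := by
    intro x
    have hx : A.orderEmbOfFin rfl x ∉ Set.range β := by
      have := A.orderEmbOfFin_mem rfl x
      exact (Finset.mem_filter.1 this).2
    obtain ⟨o, ho⟩ := φ.surjective (A.orderEmbOfFin rfl x)
    cases o with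
    | none => exact absurd (ho ▸ hnone) hx
    | some v => exact ⟨v, ho⟩
  choose a ha using hA
  have harange : ∀ v, v ∈ Set.range a ↔ v ∉ Set.range b := by
    intro v
    rw [← hrange]
    constructor
    · rintro ⟨x, rfl⟩
      rw [ha]
      have := A.orderEmbOfFin_mem rfl x
      exact (Finset.mem_filter.1 this).2
    · intro hv
      have : φ (some v) ∈ Set.range (A.orderEmbOfFin rfl) := by
        rw [Finset.range_orderEmbOfFin]; simpa [A] using hv
      obtain ⟨x, hx⟩ := this
      refine ⟨x, ?_⟩
      simpa [← ha x] using hx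
  refine ⟨A.card, N, hN, a, b, A.orderEmbOfFin rfl, β, ?_, hb, ?_, (A.orderEmbOfFin rfl).strictMono,
    hβ, ?_, ?_, hcβ⟩
  · intro x y hxy
    exact (A.orderEmbOfFin rfl).injective (by rw [← ha x, ← ha y, hxy])
  · have : Set.range a = (Set.range b)ᶜ := by ext v; exact harange v
    rw [this]; exact isCompl_compl.symm
  · have : Set.range (A.orderEmbOfFin rfl) = (Set.range β)ᶜ := by
      rw [Finset.range_orderEmbOfFin]; ext j; simp [A]
    rw [this]; exact isCompl_compl.symm
  · intro x
    change c _ = _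
    rw [← ha x]
    exact hcφ _ ((harange _).1 ⟨x, rfl⟩)

theorem CodedStore.IsChainInterleaving.xorsAtMost_two {V : Type*} [Fintype V] [DecidableEq V]
    {m : ℕ} {s : CodedStore V m} (hs : s.IsChainInterleaving) : s.XorsAtMost 2 := by
  obtain ⟨K, N, hN, a, b, α, β, -, -, -, -, -, hαβ, hα, hβ⟩ := hs
  have h1 : ∀ u : V, (Finset.univ.filter fun v : V => userChunk u v ≠ 0).card ≤ 2 := by
    intro u
    refine (Finset.card_le_card (t := {u}) fun v hv => ?_).trans (by simp)
    by_contra h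
    simp_all [userChunk, Pi.single_apply]
  have h2 : ∀ u w : V,
      (Finset.univ.filter fun v : V => (userChunk u + userChunk w) v ≠ 0).card ≤ 2 := by
    intro u w
    refine (Finset.card_le_card (t := {u, w}) fun v hv => ?_).trans Finset.card_le_two
    by_contra h
    simp_all [userChunk, Pi.single_apply]
  intro j
  have hj : j ∈ Set.range α ⊔ Set.range β := by rw [hαβ.sup_eq_top]; trivial
  rcases hj with ⟨i, rfl⟩ | ⟨i, rfl⟩
  · rw [hα]; exact h1 _
  · rw [hβ]
    unfold chainChunk
    split_ifs
    exacts [h1 _, h1 _, h2 _ _]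

/-! ### Comparing stores window by window -/

namespace CodedStore

variable {V : Type*} [DecidableEq V] {m : ℕ}

theorem windowRecovers_univ (s : CodedStore V m) (p : List V) : s.WindowRecovers 0 m p := by
  intro v _
  have : {j : Fin m | 0 ≤ (j : ℕ) ∧ (j : ℕ) < 0 + m} = Set.univ := by ext j; simp
  rw [this, Set.image_univ]
  exact s.recovers_all v

theorem minWindow_le (s : CodedStore V m) (p : List V) : s.minWindow p ≤ m :=
  Nat.sInf_le ⟨0, by simp, s.windowRecovers_univ p⟩

theorem minWindow_mono {s s' : CodedStore V m}
    (h : ∀ i L p, s.WindowRecovers i L p → s'.WindowRecovers i L p) (p : List V) :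
    s'.minWindow p ≤ s.minWindow p := by
  obtain ⟨i, hi, hr⟩ := Nat.sInf_mem (s := {L : ℕ | ∃ i : ℕ, i + L ≤ m ∧ s.WindowRecovers i L p})
    ⟨m, 0, by simp, s.windowRecovers_univ p⟩
  exact Nat.sInf_le ⟨i, hi, h _ _ _ hr⟩

theorem stretchMetric_mono {s s' : CodedStore V m}
    (h : ∀ i L p, s.WindowRecovers i L p → s'.WindowRecovers i L p) (G : SimpleGraph V) (t : ℕ) :
    s'.stretchMetric G t ≤ s.stretchMetric G t := by
  -- A real supremum is monotone only under a bound; `m` works, as files are nonempty and windows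
  -- have length at most `m`.
  refine ciSup_mono ⟨m, ?_⟩ fun p => ?_
  · rintro _ ⟨p, rfl⟩
    have h1 : (1 : ℝ) ≤ p.1.length := by
      exact_mod_cast List.length_pos_of_ne_nil p.2.1
    exact (div_le_self (by positivity) h1).trans (by exact_mod_cast s.minWindow_le p.1)
  · unfold stretchNumber
    gcongr
    exact minWindow_mono h p.1

instance [Finite V] : Finite (CodedStore V m) :=
  Finite.of_injective CodedStore.chunk fun s s' h => by cases s; cases s'; cases h; rfl

end CodedStore

/-! ### Representatives adapted to the chain -/

/-- The basis made of the differences along a chain, of the differences of the dominated chunks to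
chunks of the chain and of the remaining chunks has distinct representatives. -/
theorem exists_chain_representatives {V : Type*} [Fintype V] {m N : ℕ}
    (hm : Fintype.card V + 1 = m) (X : V → Fin m → ZMod 2) (C : Fin m → ZMod 2)
    (hspan : ∀ S : Submodule (ZMod 2) (Fin m → ZMod 2), C ∈ S → (∀ v, X v ∈ S) → S = ⊤)
    (T : Finset V) (l r : V → ℕ) (p q : ℕ) (hC : ∀ k : Fin m, C k ≠ 0 → p ≤ k ∧ (k : ℕ) ≤ q)
    (hl : ∀ v ∈ T, ∀ k : Fin m, X v k ≠ 0 → p ≤ k ∧ (k : ℕ) ≤ r v)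
    (hr : ∀ v ∈ T, ∀ k : Fin m, (X v + C) k ≠ 0 → l v ≤ k ∧ (k : ℕ) ≤ q)
    (hrq : ∀ v ∈ T, r v ≤ q)
    (b : Fin N → V) (hbT : ∀ i, b i ∈ T) (hlb : StrictMono (l ∘ b)) (hrb : StrictMono (r ∘ b))
    (hdom : ∀ u ∈ T, ∃ i, l u ≤ l (b i) ∧ r (b i) ≤ r u) :
    ∃ φ : Option V ≃ Fin m, (∀ v ∉ T, X v (φ (some v)) ≠ 0) ∧
      (∀ u ∈ T, u ∉ Set.range b → l u ≤ φ (some u) ∧ (φ (some u) : ℕ) ≤ r u) ∧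
      ∀ k : Fin (N + 1),
        (Fin.cons p (l ∘ b) : Fin (N + 1) → ℕ) k ≤
            (Fin.cons (φ none) (fun i => φ (some (b i))) : Fin (N + 1) → Fin m) k ∧
          ((Fin.cons (φ none) (fun i => φ (some (b i))) : Fin (N + 1) → Fin m) k : ℕ) ≤
            (Fin.snoc (r ∘ b) q : Fin (N + 1) → ℕ) k := by
  classical
  have hbinj : Function.Injective b := fun i j hij =>
    hlb.injective (by simp [hij])
  have hdom' : ∀ u, ∃ i : V, u ∈ T → i ∈ Set.range b ∧ l u ≤ l i ∧ r i ≤ r u := by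
    intro u
    by_cases hu : u ∈ T
    · obtain ⟨i, hi⟩ := hdom u hu
      exact ⟨b i, fun _ => ⟨⟨i, rfl⟩, hi⟩⟩
    · exact ⟨u, fun h => absurd h hu⟩
  choose dom hdom using hdom'
  have hdomT : ∀ u ∈ T, dom u ∈ T := fun u hu => by
    obtain ⟨i, hi⟩ := (hdom u hu).1
    exact hi ▸ hbT i
  let hiVec : Fin (N + 1) → Fin m → ZMod 2 := Fin.snoc (fun i => X (b i)) C
  let loVec : Fin (N + 1) → Fin m → ZMod 2 := Fin.cons 0 (fun i => X (b i))
  let lo : Fin (N + 1) → ℕ := Fin.cons p (l ∘ b)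
  let hi : Fin (N + 1) → ℕ := Fin.snoc (r ∘ b) q
  -- The differences are confined by cancellation: left of `l v` the vector `X v` equals `C`, right
  -- of `r v` it is zero. Since `l` and `r` increase along the chain, neighbours agree on both
  -- sides.
  have hpos : ∀ k j, hiVec k j - loVec k j ≠ 0 → lo k ≤ j ∧ (j : ℕ) ≤ hi k := by
    intro k j hkj
    constructor
    · by_contra hlt
      have h1 : ∀ v ∈ T, (j : ℕ) < l v → X v j = C j := by
        intro v hv hjv
        by_contra h
        have h0 : (X v + C) j ≠ 0 := by
          rw [Pi.add_apply, ← CharTwo.sub_eq_add]; exact sub_ne_zero.2 h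
        exact absurd (hr v hv j h0).1 (by omega)
      induction k using Fin.cases with
      | zero =>
        simp only [lo, Fin.cons_zero] at hlt
        apply hkj
        have h2 : hiVec 0 j = 0 := by
          by_contra h
          rcases Nat.eq_zero_or_pos N with rfl | hN
          · exact hlt (hC j h).1
          · obtain ⟨M, rfl⟩ : ∃ M, N = M + 1 := ⟨N - 1, by omega⟩
            have h3 : hiVec 0 = X (b 0) := by
              rw [← Fin.castSucc_zero]; exact Fin.snoc_castSucc ..
            rw [h3] at h
            exact hlt (hl _ (hbT 0) j h).1
        simp [h2, loVec]
      | succ i =>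
        simp only [lo, Fin.cons_succ, Function.comp, not_le] at hlt
        apply hkj
        have h2 : loVec i.succ j = C j := h1 _ (hbT i) hlt
        rw [h2, sub_eq_zero]
        rcases Fin.eq_castSucc_or_eq_last i.succ with ⟨i', hi'⟩ | hlast
        · rw [hi']
          simp only [hiVec, Fin.snoc_castSucc]
          refine h1 _ (hbT i') (hlt.trans ?_)
          have := congrArg Fin.val hi'
          simp only [Fin.val_succ, Fin.val_castSucc] at this
          exact hlb (by rw [Fin.lt_def]; omega)
        · rw [hlast]; simp [hiVec]
    · by_contra hlt
      apply hkj
      have h1 : ∀ v ∈ T, r v < j → X v j = 0 := by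
        intro v hv hjv
        by_contra h
        exact absurd (hl v hv j h).2 (by omega)
      induction k using Fin.lastCases with
      | last =>
        simp only [hi, Fin.snoc_last, not_le] at hlt
        have h2 : C j = 0 := by
          by_contra h; exact absurd (hC j h).2 (by omega)
        have h3 : loVec (Fin.last N) j = 0 := by
          rcases Fin.eq_zero_or_eq_succ (Fin.last N) with h0 | ⟨i, h0⟩
          · rw [h0]; simp [loVec]
          · rw [h0]; exact h1 _ (hbT i) ((hrq _ (hbT i)).trans_lt hlt)
        simp [hiVec, h2, h3]
      | cast i =>
        simp only [hi, Fin.snoc_castSucc, Function.comp, not_le] at hlt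
        have h2 : hiVec i.castSucc j = 0 := by
          simp only [hiVec, Fin.snoc_castSucc]; exact h1 _ (hbT i) hlt
        have h3 : loVec i.castSucc j = 0 := by
          rcases Fin.eq_zero_or_eq_succ i.castSucc with h0 | ⟨i', h0⟩
          · rw [h0]; simp [loVec]
          · rw [h0]
            refine h1 _ (hbT i') (lt_trans ?_ hlt)
            have := congrArg Fin.val h0
            simp only [Fin.val_succ, Fin.val_castSucc] at this
            exact hrb (show i' < i by rw [Fin.lt_def]; omega)
        rw [h2, h3, sub_zero]
  -- Subtracting the dominator confines a dominated `u` to `[l u, r u]`, which is contained in both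
  -- `[p, r u]` and `[l u, q]`.
  let w : Option V → Fin m → ZMod 2 := fun o => o.elim (hiVec 0 - loVec 0) fun v =>
    if h : ∃ i, b i = v then hiVec h.choose.succ - loVec h.choose.succ
    else if v ∈ T then X v - X (dom v) else X v
  have hwb : ∀ i, w (some (b i)) = hiVec i.succ - loVec i.succ := by
    intro i
    have h : ∃ i', b i' = b i := ⟨i, rfl⟩
    simp only [w, Option.elim_some, dif_pos h]
    rw [hbinj h.choose_spec]
  have hwT : ∀ u ∈ T, u ∉ Set.range b → w (some u) = X u - X (dom u) := by
    intro u hu hub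
    have h : ¬ ∃ i', b i' = u := hub
    simp [w, dif_neg h, hu]
  have hwn : ∀ u ∉ T, w (some u) = X u := by
    intro u hu
    have h : ¬ ∃ i', b i' = u := by rintro ⟨i, rfl⟩; exact hu (hbT i)
    simp [w, dif_neg h, hu]
  have htop : Submodule.span (ZMod 2) (Set.range w) = ⊤ := by
    set S := Submodule.span (ZMod 2) (Set.range w)
    have hS : ∀ o, w o ∈ S := fun o => Submodule.subset_span ⟨o, rfl⟩
    have hd : ∀ k, hiVec k - loVec k ∈ S := by
      intro k
      induction k using Fin.cases with
      | zero => exact hS none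
      | succ i => rw [← hwb]; exact hS _
    -- The sums telescope, as `loVec i.succ` and `hiVec i.castSucc` are both `X (b i)`.
    have hlo : ∀ k, loVec k ∈ S := by
      intro k
      induction k using Fin.induction with
      | zero => simp [loVec]
      | succ i ih =>
        have := S.add_mem (hd i.castSucc) ih
        rw [sub_add_cancel] at this
        simpa [hiVec, loVec] using this
    have hXb : ∀ i, X (b i) ∈ S := fun i => by simpa [loVec] using hlo i.succ
    refine hspan S ?_ fun v => ?_
    · have := S.add_mem (hd (Fin.last N)) (hlo (Fin.last N))
      rw [sub_add_cancel] at this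
      simpa [hiVec] using this
    · by_cases hvb : v ∈ Set.range b
      · obtain ⟨i, rfl⟩ := hvb
        exact hXb i
      · by_cases hvT : v ∈ T
        · have hXd : X (dom v) ∈ S := by
            obtain ⟨i, hi⟩ := (hdom v hvT).1
            exact hi ▸ hXb i
          have := S.add_mem (hS (some v)) hXd
          rwa [hwT v hvT hvb, sub_add_cancel] at this
        · rw [← hwn v hvT]; exact hS _
  obtain ⟨φ, hφ⟩ := exists_equiv_apply_ne_zero (by simpa using hm) w htop
  refine ⟨φ, fun v hv => ?_, fun u hu hub => ?_, fun k => ?_⟩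
  · rw [← hwn v hv]; exact hφ _
  · have h := hφ (some u)
    rw [hwT u hu hub, Pi.sub_apply] at h
    constructor
    · by_contra hlt
      have h1 : ∀ v ∈ T, l u ≤ l v → X v (φ (some u)) = C (φ (some u)) := by
        intro v hv huv
        by_contra h
        have h0 : (X v + C) (φ (some u)) ≠ 0 := by
          rw [Pi.add_apply, ← CharTwo.sub_eq_add]; exact sub_ne_zero.2 h
        exact absurd (hr v hv _ h0).1 (by omega)
      exact h (by rw [h1 u hu le_rfl, h1 _ (hdomT u hu) (hdom u hu).2.1, sub_self])
    · by_contra hlt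
      have h1 : ∀ v ∈ T, r v ≤ r u → X v (φ (some u)) = 0 := by
        intro v hv huv
        by_contra h
        exact absurd (hl v hv _ h).2 (by omega)
      exact h (by rw [h1 u hu le_rfl, h1 _ (hdomT u hu) (hdom u hu).2.2, sub_self])
  · apply hpos
    induction k using Fin.cases with
    | zero => exact hφ none
    | succ i =>
      have := hφ (some (b i))
      rwa [hwb] at this

/-! ### The unique relation and the replacement store -/

namespace CodedStore

variable {V : Type*} [Fintype V] [DecidableEq V]

/-- The stored chunks of a store with one redundant chunk satisfy exactly one linear relation. -/
theorem exists_circuit (s : CodedStore V (Fintype.card V + 1)) :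
    ∃ C : Fin (Fintype.card V + 1) → ZMod 2, C ≠ 0 ∧
      Fintype.linearCombination (ZMod 2) s.chunk C = 0 ∧
      ∀ x, Fintype.linearCombination (ZMod 2) s.chunk x = 0 → x = 0 ∨ x = C := by
  set Φ := Fintype.linearCombination (ZMod 2) s.chunk
  have hrange : LinearMap.range Φ = ⊤ := by
    rw [Fintype.range_linearCombination, eq_top_iff,
      ← (Pi.basisFun (ZMod 2) V).span_eq, Submodule.span_le]
    rintro _ ⟨v, rfl⟩
    simpa [userChunk] using s.recovers_all v
  have h1 := Φ.finrank_range_add_finrank_ker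
  rw [hrange, finrank_top] at h1
  simp only [Module.finrank_fintype_fun_eq_card, Fintype.card_fin] at h1
  -- Rank-nullity leaves a line of relations, and a line over `𝔽₂` has one nonzero vector.
  have h2 : Module.finrank (ZMod 2) (LinearMap.ker Φ) = 1 := by omega
  obtain ⟨C, hC, h⟩ := finrank_eq_one_iff'.1 h2
  refine ⟨C, by simpa using hC, C.2, fun x hx => ?_⟩
  obtain ⟨c, hc⟩ := h ⟨x, hx⟩
  have hx' : c • (C : Fin (Fintype.card V + 1) → ZMod 2) = x := congrArg Subtype.val hc
  have hcase : ∀ c : ZMod 2, c = 0 ∨ c = 1 := by decide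
  rcases hcase c with rfl | rfl
  · left; simpa using hx'.symm
  · right; simpa using hx'.symm

/-- Every store with one redundant chunk can be replaced by a chain interleaving that recovers
every file at every window where the given store does. -/
theorem exists_chainInterleaving_windowRecovers [Nonempty V]
    (s : CodedStore V (Fintype.card V + 1)) :
    ∃ s' : CodedStore V (Fintype.card V + 1), s'.IsChainInterleaving ∧
      ∀ i L p, s.WindowRecovers i L p → s'.WindowRecovers i L p := by
  classical
  obtain ⟨C, hC0, hΦC, hker⟩ := s.exists_circuit
  set Φ := Fintype.linearCombination (ZMod 2) s.chunk with hΦ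
  have hA : ∀ v : V, ∃ A, Φ A = userChunk v := by
    intro v
    have h := s.recovers_all v
    rw [← Fintype.range_linearCombination] at h
    exact h
  choose A hA using hA
  have hsupp : (Finset.univ.filter fun k => C k ≠ 0).Nonempty := by
    obtain ⟨k, hk⟩ := Function.ne_iff.1 hC0
    exact ⟨k, by simpa using hk⟩
  obtain ⟨p, hp, hp'⟩ := Finset.exists_min_image _ id hsupp
  obtain ⟨q, hq, hq'⟩ := Finset.exists_max_image _ id hsupp
  simp only [Finset.mem_filter, Finset.mem_univ, true_and, id] at hp hp' hq hq'
  have hCpq : ∀ k, C k ≠ 0 → p ≤ k ∧ k ≤ q := fun k hk => ⟨hp' k hk, hq' k hk⟩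
  choose X hXA hX using fun v => support_dichotomy (A v) hp hq hCpq
  have hΦX : ∀ v, Φ (X v) = userChunk v := by
    intro v
    rcases hXA v with h | h <;> simp [h, hA, hΦC]
  have hrec : ∀ v i L, userChunk v ∈ Submodule.span (ZMod 2)
      (s.chunk '' {j | i ≤ (j : ℕ) ∧ (j : ℕ) < i + L}) →
      SupportedIn (A v) i (i + L) ∨ SupportedIn (A v + C) i (i + L) := by
    intro v i L h
    obtain ⟨y, hy, hyv⟩ := exists_coeff_of_mem_span_image h
    have h0 : Φ (y - A v) = 0 := by rw [map_sub, hA, sub_eq_zero]; exact hyv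
    rcases hker _ h0 with h1 | h1
    · left; rw [← sub_eq_zero.1 h1]; exact hy
    · right; rw [← h1, add_sub_cancel]; exact hy
  have hspan : ∀ S : Submodule (ZMod 2) (Fin (Fintype.card V + 1) → ZMod 2),
      C ∈ S → (∀ v, X v ∈ S) → S = ⊤ := by
    intro S hCS hXS
    refine eq_top_iff.2 fun x _ => ?_
    have hsum : ∑ v, (Φ x) v • X v ∈ S := S.sum_mem fun v _ => S.smul_mem _ (hXS v)
    have h0 : Φ (x - ∑ v, (Φ x) v • X v) = 0 := by
      rw [map_sub, map_sum, sub_eq_zero]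
      simp only [map_smul, hΦX, userChunk]
      ext u
      simp [Finset.sum_apply, Pi.single_apply]
    have h1 : x - ∑ v, (Φ x) v • X v ∈ S := by
      rcases hker _ h0 with h | h <;> rw [h]
      exacts [S.zero_mem, hCS]
    simpa using S.add_mem h1 hsum
  let TypeI : V → Prop := fun v =>
    ∀ i j, SupportedIn (A v) i j ∨ SupportedIn (A v + C) i j → SupportedIn (X v) i j
  have hII : ∀ v, ∃ l r : Fin (Fintype.card V + 1), ¬ TypeI v →
      (∀ k, X v k ≠ 0 → p ≤ k ∧ k ≤ r) ∧ (∀ k, (X v + C) k ≠ 0 → l ≤ k ∧ k ≤ q) ∧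
        p ≤ l ∧ r ≤ q ∧
        ∀ i j, SupportedIn (A v) i j ∨ SupportedIn (A v + C) i j →
          (i ≤ (p : ℕ) ∧ (r : ℕ) < j) ∨ (i ≤ (l : ℕ) ∧ (q : ℕ) < j) := by
    intro v
    rcases hX v with h | ⟨l, r, h⟩
    · exact ⟨0, 0, fun h' => absurd h h'⟩
    · exact ⟨l, r, fun _ => h⟩
  choose l r hlr using hII
  let T : Finset V := Finset.univ.filter fun v => ¬ TypeI v
  have hT : ∀ v ∈ T, ¬ TypeI v := fun v hv => (Finset.mem_filter.1 hv).2
  have hT' : ∀ v ∉ T, TypeI v := fun v hv => by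
    by_contra h; exact hv (Finset.mem_filter.2 ⟨Finset.mem_univ _, h⟩)
  obtain ⟨N, b, hbT, hlb, hrb, hdom⟩ :=
    exists_strictMono_dominating (fun v => (l v : ℕ)) (fun v => (r v : ℕ)) T
  obtain ⟨φ, hφ1, hφ2, hφ3⟩ := exists_chain_representatives rfl X C hspan T
    (fun v => (l v : ℕ)) (fun v => (r v : ℕ)) p q hCpq (fun v hv => (hlr v (hT v hv)).1)
    (fun v hv => (hlr v (hT v hv)).2.1)
    (fun v hv => (hlr v (hT v hv)).2.2.2.1) b hbT hlb hrb hdom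
  have hγinj : ∀ {M : ℕ} (b : Fin M → V), Function.Injective b →
      Function.Injective (Fin.cons (φ none) fun i => φ (some (b i)) :
        Fin (M + 1) → Fin (Fintype.card V + 1)) := fun b hb => by
    rw [Fin.cons_injective_iff]
    exact ⟨by simp, fun i j hij => hb (by simpa using hij)⟩
  have hsingle : ∀ (s' : CodedStore V (Fintype.card V + 1)) (v : V) (i L : ℕ),
      v ∉ Set.range b → s'.chunk (φ (some v)) = userChunk v →
      SupportedIn (A v) i (i + L) ∨ SupportedIn (A v + C) i (i + L) →
      userChunk v ∈ Submodule.span (ZMod 2)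
        (s'.chunk '' {j | i ≤ (j : ℕ) ∧ (j : ℕ) < i + L}) := by
    intro s' v i L hvb hv h
    refine Submodule.subset_span ⟨φ (some v), ?_, hv⟩
    by_cases hvT : v ∈ T
    · have h1 := hφ2 v hvT hvb
      obtain ⟨-, -, h2, h3, h4⟩ := hlr v (hT v hvT)
      have h5 := h4 _ _ h
      simp only [Fin.le_def] at h2 h3
      simp only [Set.mem_ofPred_eq]
      omega
    · exact hT' v hvT _ _ h _ (hφ1 v hvT)
  -- If `T` is empty, the chain still needs a member. With a single `v₀` it stores `v₀` twice, at `φ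
  -- none` and `φ (some v₀)`, so `v₀` also stands uncoded at its own position.
  rcases Nat.eq_zero_or_pos N with rfl | hN
  · obtain ⟨v₀⟩ := ‹Nonempty V›
    have hb₀ : Function.Injective fun _ : Fin 1 => v₀ := Function.injective_of_subsingleton _
    obtain ⟨β, hβ, hβr, -⟩ := exists_strictMono_representatives _ (hγinj _ hb₀)
    obtain ⟨s', hs', h1, h2⟩ := exists_chainInterleaving one_pos _ hb₀ φ β hβ hβr
    refine ⟨s', hs', fun i L f hf v hv => ?_⟩
    refine hsingle s' v i L (by rintro ⟨i, -⟩; exact i.elim0) ?_ (hrec v i L (hf v hv))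
    by_cases hvv : v = v₀
    · subst hvv
      obtain ⟨k, hk⟩ : φ (some v) ∈ Set.range β := by
        rw [hβr]; exact ⟨1, rfl⟩
      rw [← hk, h2]
      fin_cases k <;> simp [chainChunk]
    · exact h1 v (by rintro ⟨_, h⟩; exact hvv h.symm)
  · have hbinj : Function.Injective b := fun i j hij => hlb.injective (by simp [hij])
    obtain ⟨β, hβ, hβr, hβ'⟩ := exists_strictMono_representatives _ (hγinj b hbinj)
    -- Sorting preserves the bounds because both interval ends are monotone along the chain: `p` is
    -- at most every `l`, and `q` at least every `r`.
    have hβ'' := hβ' _ _ ?_ ?_ hφ3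
    · obtain ⟨s', hs', h1, h2⟩ := exists_chainInterleaving hN b hbinj φ β hβ hβr
      refine ⟨s', hs', fun i L f hf v hv => ?_⟩
      have h := hrec v i L (hf v hv)
      by_cases hvb : v ∈ Set.range b
      · obtain ⟨k, rfl⟩ := hvb
        have hbet : ∀ j, (p : ℕ) ≤ β j ∧ (β j : ℕ) ≤ q := by
          intro j
          have h3 := (hβ'' 0).1
          have h4 := (hβ'' (Fin.last N)).2
          simp only [Fin.cons_zero, Fin.snoc_last] at h3 h4
          exact ⟨h3.trans (hβ.monotone (Fin.zero_le j)), le_trans (hβ.monotone (Fin.le_last j)) h4⟩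
        have h3 := (hβ'' k.castSucc).2
        have h4 := (hβ'' k.succ).1
        simp only [Fin.snoc_castSucc, Fin.cons_succ, Function.comp] at h3 h4
        -- A window over `[p, r (b k)]` contains the prefix ending at `β k.castSucc`; one over `[l
        -- (b k), q]` contains the suffix starting at `β k.succ`.
        rcases (hlr _ (hT _ (hbT k))).2.2.2.2 _ _ h with h5 | h5
        · refine userChunk_mem_of_chainChunk_le hN b _ k k.2 fun j hj => ?_
          refine Submodule.subset_span ⟨β j, ?_, h2 j⟩
          have h6 : β j ≤ β k.castSucc := hβ.monotone (by simpa [Fin.le_def] using hj)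
          have h7 := hbet j
          simp only [Fin.le_def] at h6
          simp only [Set.mem_ofPred_eq]
          omega
        · refine userChunk_mem_of_chainChunk_gt hN b _ (N - 1 - k) k k.2 (by omega) fun j hj => ?_
          refine Submodule.subset_span ⟨β j, ?_, h2 j⟩
          have h6 : β k.succ ≤ β j := hβ.monotone (by simpa [Fin.le_def] using hj)
          have h7 := hbet j
          simp only [Fin.le_def] at h6
          simp only [Set.mem_ofPred_eq]
          omega
      · exact hsingle s' v i L hvb (h1 v hvb) h
    · intro i j hij
      induction i using Fin.cases with
      | zero =>
        induction j using Fin.cases with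
        | zero => exact le_rfl
        | succ j => exact (hlr _ (hT _ (hbT j))).2.2.1
      | succ i =>
        induction j using Fin.cases with
        | zero => exact absurd hij (by simp)
        | succ j => exact hlb.monotone (Fin.succ_le_succ_iff.1 hij)
    · intro i j hij
      induction j using Fin.lastCases with
      | last =>
        induction i using Fin.lastCases with
        | last => exact le_rfl
        | cast i =>
          simp only [Fin.snoc_last, Fin.snoc_castSucc]
          exact (hlr _ (hT _ (hbT i))).2.2.2.1
      | cast j =>
        induction i using Fin.lastCases with
        | last => exact absurd hij (by simp)
        | cast i =>
          simp only [Fin.snoc_castSucc]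
          exact hrb.monotone (Fin.castSucc_le_castSucc_iff.1 hij)

theorem nonempty_succ_card : Nonempty (CodedStore V (Fintype.card V + 1)) := by
  let e := Fintype.equivFin V
  refine ⟨⟨Fin.snoc (fun j => userChunk (e.symm j)) 0, fun v => Submodule.subset_span ?_⟩⟩
  exact ⟨(e v).castSucc, by simp⟩

end CodedStore

theorem mainTheorem8 {V : Type*} [Fintype V] [DecidableEq V] [Nonempty V]
    (G : SimpleGraph V) (t : ℕ) (ht : 1 ≤ t) (htn : t ≤ Fintype.card V) :
    (∃ s : CodedStore V (Fintype.card V + 1),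
      s.IsChainInterleaving ∧ s.IsOptimal G t ∧ s.XorsAtMost 2) ∧
    (∀ s : CodedStore V (Fintype.card V + 1), s.IsChainInterleaving → s.XorsAtMost 2) ∧
    xorStretch G t (Fintype.card V + 1) 2 = codedStretch G t (Fintype.card V + 1) := by
  have := CodedStore.nonempty_succ_card (V := V)
  obtain ⟨s₀, hs₀⟩ := Finite.exists_min
    fun s : CodedStore V (Fintype.card V + 1) => s.stretchMetric G t
  obtain ⟨s, hs, hrec⟩ := s₀.exists_chainInterleaving_windowRecovers
  have hopt : s.IsOptimal G t := fun s' =>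
    (CodedStore.stretchMetric_mono hrec G t).trans (hs₀ s')
  have hx := hs.xorsAtMost_two
  refine ⟨⟨s, hs, hopt, hx⟩, fun s' hs' => hs'.xorsAtMost_two, ?_⟩
  -- The same store attains both infima, being optimal among all stores and a member of the
  -- restricted class.
  have h1 : codedStretch G t (Fintype.card V + 1) = s.stretchMetric G t :=
    IsLeast.csInf_eq ⟨⟨s, rfl⟩, by rintro _ ⟨s', rfl⟩; exact hopt s'⟩
  have h2 : xorStretch G t (Fintype.card V + 1) 2 = s.stretchMetric G t :=
    IsLeast.csInf_eq ⟨⟨⟨s, hx⟩, rfl⟩, by rintro _ ⟨s', rfl⟩; exact hopt s'.1⟩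
  rw [h1, h2]
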